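/- Let $r=(r_n)_{n\ge1}$, $a=(a_n)_{n\ge1}$, $d=(d_n)_{n\ge1}$ be real sequences with $r_n>0$ and $d_n\ge 0$ for all $n\ge 1$, $a_1=0$, and $a_n>0$ for $n\ge2$. Put $\theta_n=r_n+a_n+d_n$ and let $$X=\Bigl\{f=(f_n)_{n\ge1}\subset\mathbb R:\ \|f\|=\sum_{n=1}^\infty n|f_n|<\infty\Bigr\}.$$ Define operators in $X$ by $$[A_0f]_n=-\theta_nf_n,\quad D(A_0)=\{f\in X:(\theta_nf_n)_n\in X\},\qquad [A_1f]_n=r_{n+1}f_{n+1},\quad D(A_1)=\{f\in X:(r_nf_n)_n\in X\}.$$ A substochastic semigroup on $X$ is a strongly continuous semigroup $\{S(t)\}_{t\ge0}$ of bounded linear operators on $X$ which are positive (with respect to the termwise order) and satisfy $\|S(t)\|\le1$. Let $K$ denote the generator of the smallest substochastic semigroup generated by an extension of $A_0+A_1$; that is, $K\supseteq A_0+A_1$ generates a substochastic semigroup $\{S(t)\}_{t\ge0}$, and $S(t)f\le S'(t)f$ for all $t\ge0$ and $0\le f\in X$ whenever $\{S'(t)\}_{t\ge0}$ is a substochastic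 semigroup whose generator extends $A_0+A_1$. If there is a constant $C>0$ such that $$d_n+a_n\ge C\,r_n\qquad\text{for all } n\ge1,$$ then $K$ exists, $D(K)=D(A_0)$ and $K=A_0+A_1$. In particular, $A_0+A_1$ with domain $D(A_0)$ is already closed, so that no closure is needed. -/

import Mathlib

open Filter Topology
open scoped NNReal

namespace DecayFragmentation

/-! The weighted sequence space `X = {f = (f_n)_{n ≥ 1} : ∑ n |f_n| < ∞}`, sequences being indexed
by the positive integers. -/

/-- Membership in `X`: the series `∑ n |f n|` converges. -/
def MemX (f : ℕ+ → ℝ) : Prop := Summable fun n : ℕ+ => (n : ℝ) * |f n|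

theorem MemX.of_le {f g : ℕ+ → ℝ} (hg : MemX g) (h : ∀ n, |f n| ≤ |g n|) : MemX f :=
  Summable.of_nonneg_of_le (fun n => by positivity)
    (fun n => mul_le_mul_of_nonneg_left (h n) (by positivity)) hg

theorem memX_zero : MemX 0 := by simp [MemX, summable_zero]

theorem MemX.add {f g : ℕ+ → ℝ} (hf : MemX f) (hg : MemX g) : MemX (f + g) := by
  refine Summable.of_nonneg_of_le (fun n => by positivity) (fun n => ?_) (Summable.add hf hg)
  rw [← mul_add]
  exact mul_le_mul_of_nonneg_left (abs_add_le _ _) (by positivity)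

theorem MemX.smul {f : ℕ+ → ℝ} (c : ℝ) (hf : MemX f) : MemX (c • f) := by
  refine (Summable.mul_left |c| hf).congr fun n => ?_
  simp only [Pi.smul_apply, smul_eq_mul, abs_mul]
  ring

/-- `X` as a linear subspace of the space of all real sequences. -/
def subspaceX : Submodule ℝ (ℕ+ → ℝ) where
  carrier := {f | MemX f}
  add_mem' := MemX.add
  zero_mem' := memX_zero
  smul_mem' c _ hf := MemX.smul c hf

/-- The space `X` as a type of its own (so that it carries only the norm topology below). -/
def X : Type := subspaceX

namespace X

noncomputable instance : AddCommGroup X := inferInstanceAs (AddCommGroup subspaceX)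

noncomputable instance : Module ℝ X := inferInstanceAs (Module ℝ subspaceX)

instance : CoeFun X (fun _ => ℕ+ → ℝ) := ⟨fun f => Subtype.val f⟩

/-- The element of `X` given by a sequence `f` with `∑ n |f n| < ∞`. -/
def mk (f : ℕ+ → ℝ) (hf : MemX f) : X := ⟨f, hf⟩

theorem memX (f : X) : MemX f := f.property

@[ext] theorem ext {f g : X} (h : ∀ n, f n = g n) : f = g := Subtype.ext (funext h)

@[simp] theorem mk_apply (f : ℕ+ → ℝ) (hf : MemX f) (n : ℕ+) : mk f hf n = f n := rfl

@[simp] theorem zero_apply (n : ℕ+) : (0 : X) n = 0 := rfl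

@[simp] theorem add_apply (f g : X) (n : ℕ+) : (f + g) n = f n + g n := rfl

@[simp] theorem neg_apply (f : X) (n : ℕ+) : (-f) n = -f n := rfl

@[simp] theorem sub_apply (f g : X) (n : ℕ+) : (f - g) n = f n - g n := rfl

@[simp] theorem smul_apply (c : ℝ) (f : X) (n : ℕ+) : (c • f) n = c * f n := rfl

/-- The norm `‖f‖ = ∑ n |f n|` of `X`. -/
noncomputable def normX : AddGroupNorm X where
  toFun f := ∑' n : ℕ+, (n : ℝ) * |f n|
  map_zero' := by simp
  add_le' f g := by
    rw [← Summable.tsum_add f.memX g.memX]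
    refine Summable.tsum_le_tsum (fun n => ?_) (f + g).memX (Summable.add f.memX g.memX)
    rw [← mul_add]
    exact mul_le_mul_of_nonneg_left (abs_add_le _ _) (by positivity)
  neg' f := by simp
  eq_zero_of_map_eq_zero' f hf := by
    have h := (hasSum_zero_iff_of_nonneg (fun n : ℕ+ => by positivity)).1
      (hf ▸ Summable.hasSum f.memX : HasSum (fun n : ℕ+ => (n : ℝ) * |f n|) 0)
    ext n
    have hn := congrFun h n
    have hpos : (n : ℝ) ≠ 0 := by exact_mod_cast n.ne_zero
    simpa [hpos] using hn

noncomputable instance : NormedAddCommGroup X := normX.toNormedAddCommGroup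

theorem norm_def (f : X) : ‖f‖ = ∑' n : ℕ+, (n : ℝ) * |f n| := rfl

noncomputable instance : NormedSpace ℝ X where
  norm_smul_le c f := by
    rw [norm_def, norm_def, Real.norm_eq_abs, ← tsum_mul_left]
    refine le_of_eq (tsum_congr fun n => ?_)
    rw [smul_apply, abs_mul]
    ring

/-- Nonnegative elements of `X`: all terms are nonnegative. -/
def Nonneg (f : X) : Prop := ∀ n, 0 ≤ f n

end X

/-! The diagonal and off-diagonal parts of the decay operator. -/

/-- `θ_n = r_n + a_n + d_n`. -/
def theta (r a d : ℕ+ → ℝ) (n : ℕ+) : ℝ := r n + a n + d n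

/-- The maximal domain `{f ∈ X : w f ∈ X}` of multiplication by the sequence `w`. -/
def mulDomain (w : ℕ+ → ℝ) : Submodule ℝ X where
  carrier := {f | MemX fun n => w n * f n}
  add_mem' {f g} hf hg := by
    have h := MemX.add hf hg
    refine h.of_le fun n => le_of_eq ?_
    simp [mul_add]
  zero_mem' := by
    refine memX_zero.of_le fun n => le_of_eq ?_
    simp
  smul_mem' c f hf := by
    refine (MemX.smul c hf).of_le fun n => le_of_eq ?_
    simp only [X.smul_apply, Pi.smul_apply, smul_eq_mul]
    congr 1
    ring

/-- If `g ∈ X` then the left shift `(g_{n+1})_n` is in `X`. -/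
theorem MemX.shift {g : ℕ+ → ℝ} (hg : MemX g) : MemX fun n => g (n + 1) := by
  have hinj : Function.Injective fun n : ℕ+ => n + 1 := fun m n hmn => add_right_cancel hmn
  have h : Summable fun n : ℕ+ => ((n + 1 : ℕ+) : ℝ) * |g (n + 1)| := by
    have h0 : Summable fun n : ℕ+ => (n : ℝ) * |g n| := hg
    exact h0.comp_injective hinj
  refine Summable.of_nonneg_of_le (fun n => by positivity) (fun n => ?_) h
  refine mul_le_mul_of_nonneg_right ?_ (abs_nonneg _)
  push_cast
  linarith

/-- `[A₀ f]_n = -θ_n f_n` on `D(A₀) = {f ∈ X : θ f ∈ X}`. -/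
noncomputable def A₀ (r a d : ℕ+ → ℝ) : X →ₗ.[ℝ] X where
  domain := mulDomain (theta r a d)
  toFun :=
    { toFun := fun f => X.mk (fun n => -theta r a d n * (f : X) n)
        (MemX.of_le f.property fun n => le_of_eq (by simp [abs_mul]))
      map_add' := fun f g => by ext n; simp [mul_add]
      map_smul' := fun c f => by ext n; simp; ring }

/-- `[A₁ f]_n = r_{n+1} f_{n+1}` on `D(A₁) = {f ∈ X : r f ∈ X}`. -/
noncomputable def A₁ (r : ℕ+ → ℝ) : X →ₗ.[ℝ] X where
  domain := mulDomain r
  toFun :=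
    { toFun := fun f => X.mk (fun n => r (n + 1) * (f : X) (n + 1))
        (MemX.shift (g := fun n => r n * (f : X) n) f.property)
      map_add' := fun f g => by ext n; simp [mul_add]
      map_smul' := fun c f => by ext n; simp; ring }

/-! Substochastic semigroups on `X` and their generators. -/

/-- `S` is a strongly continuous semigroup on `X` consisting of positive contractions. -/
structure IsSubstochasticSemigroup (S : ℝ≥0 → X →L[ℝ] X) : Prop where
  map_zero : S 0 = ContinuousLinearMap.id ℝ X
  map_add : ∀ s t, S (s + t) = (S s).comp (S t)
  tendsto_zero : ∀ f, Tendsto (fun t => S t f) (𝓝 0) (𝓝 f)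
  nonneg : ∀ t f, X.Nonneg f → X.Nonneg (S t f)
  contraction : ∀ t f, ‖S t f‖ ≤ ‖f‖

/-- `K` is the (infinitesimal) generator of `S`: `f ∈ D(K)` and `K f = g` if and only if
`(S(t) f - f) / t → g` in `X` as `t → 0+`. -/
def IsGenerator (S : ℝ≥0 → X →L[ℝ] X) (K : X →ₗ.[ℝ] X) : Prop :=
  ∀ f g : X, (f, g) ∈ K.graph ↔
    Tendsto (fun t : ℝ≥0 => (t : ℝ)⁻¹ • (S t f - f)) (𝓝[>] 0) (𝓝 g)

/-- `K` is an extension of `T` which generates a substochastic semigroup `S`, and `S` is the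
smallest of all substochastic semigroups that are generated by extensions of `T`. -/
def IsMinimalSubstochasticGenerator (T K : X →ₗ.[ℝ] X) : Prop :=
  T ≤ K ∧ ∃ S : ℝ≥0 → X →L[ℝ] X, IsSubstochasticSemigroup S ∧ IsGenerator S K ∧
    ∀ (K' : X →ₗ.[ℝ] X) (S' : ℝ≥0 → X →L[ℝ] X), T ≤ K' → IsSubstochasticSemigroup S' →
      IsGenerator S' K' → ∀ (t : ℝ≥0) (f : X), X.Nonneg f → ∀ n, S t f n ≤ S' t f n

end DecayFragmentation

/-! Write T for A₀ + A₁ on D(A₀). The heart of the matter is that 1 - T is onto. Substituting u = (1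
+ θ)f turns f - Tf = y into u - Qu = y, where Q multiplies by r/(1 + θ) and then shifts left. The
shift does not increase the weighted norm, and C r ≤ a + d gives r/(1 + θ) ≤ 1/(1 + C), so ‖Q‖ < 1
and the Neumann series solves the equation (`exists_sub_eq`).

Generators of contraction semigroups are dissipative, so 1 - K is injective for every generator K.
If K extends T, surjectivity of 1 - T then leaves no room for a proper extension
(`mem_graph_of_surjective`); the same argument gives closedness.

It remains to construct one substochastic semigroup whose generator extends T. The truncations of T
to {1, …, N} are bounded, and their exponentials are positive contractions. Since T only moves mass
from n + 1 to n, these exponentials agree on finitely supported sequences once N is large, so they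
converge strongly by density. Minimality is then automatic: every competitor has generator T, and
the generator determines the semigroup. -/

namespace DecayFragmentation

open NormedSpace

/-! ### Completeness of X; shift, multiplication and truncation operators -/

namespace X

/-- If `|g n| + |h n| ≤ c |f n|` termwise, then `‖g‖ + ‖h‖ ≤ c ‖f‖`. -/
theorem norm_add_norm_le {f g h : X} {c : ℝ} (H : ∀ n, |g n| + |h n| ≤ c * |f n|) :
    ‖g‖ + ‖h‖ ≤ c * ‖f‖ := by
  rw [norm_def, norm_def, norm_def, ← tsum_mul_left, ← Summable.tsum_add g.memX h.memX]
  refine Summable.tsum_le_tsum (fun n => ?_) (Summable.add g.memX h.memX)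
    (Summable.mul_left c f.memX)
  have := mul_le_mul_of_nonneg_left (H n) (by positivity : (0 : ℝ) ≤ n)
  linarith

theorem norm_le_mul_norm {f g : X} {c : ℝ} (H : ∀ n, |g n| ≤ c * |f n|) : ‖g‖ ≤ c * ‖f‖ := by
  simpa using norm_add_norm_le (h := 0) (by simpa using H)

theorem abs_apply_le_norm (f : X) (n : ℕ+) : |f n| ≤ ‖f‖ := by
  have h1 : (n : ℝ) * |f n| ≤ ‖f‖ := by
    rw [norm_def]
    exact f.memX.le_tsum n fun m _ => by positivity
  have h2 : (1 : ℝ) ≤ n := by exact_mod_cast n.pos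
  nlinarith [abs_nonneg (f n)]

/-- The `n`-th coordinate as a continuous linear functional. -/
noncomputable def coordL (n : ℕ+) : X →L[ℝ] ℝ :=
  LinearMap.mkContinuous
    { toFun := fun f => f n
      map_add' := fun _ _ => rfl
      map_smul' := fun _ _ => rfl } 1 fun f => by
      rw [one_mul]
      exact abs_apply_le_norm f n

@[simp] theorem coordL_apply (n : ℕ+) (f : X) : coordL n f = f n := rfl

theorem memℓp_weighted (f : X) : Memℓp (E := fun _ : ℕ+ => ℝ) (fun n => (n : ℝ) * f n) 1 := by
  refine memℓp_gen ?_
  simpa [abs_mul, MemX] using f.memX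

/-- The isometric identification of `X` with `ℓ¹` by `f ↦ (n f_n)_n`. -/
noncomputable def toLp : X ≃ᵢ lp (fun _ : ℕ+ => ℝ) 1 where
  toFun f := ⟨fun n => (n : ℝ) * f n, f.memℓp_weighted⟩
  invFun g := mk (fun n => (n : ℝ)⁻¹ * g n) (by
    have := g.2.summable (by norm_num)
    simp only [ENNReal.toReal_one, Real.rpow_one, Real.norm_eq_abs] at this
    refine this.congr fun n => ?_
    have hn : (n : ℝ) ≠ 0 := by exact_mod_cast n.ne_zero
    rw [abs_mul, abs_inv, Nat.abs_cast, mul_inv_cancel_left₀ hn])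
  left_inv f := by
    ext n
    exact inv_mul_cancel_left₀ (by exact_mod_cast n.ne_zero) _
  right_inv g := by
    ext n
    exact mul_inv_cancel_left₀ (by exact_mod_cast n.ne_zero) _
  isometry_toFun := by
    refine Isometry.of_dist_eq fun f g => ?_
    rw [dist_eq_norm, dist_eq_norm, lp.norm_eq_tsum_rpow (by norm_num), norm_def]
    rw [ENNReal.toReal_one, div_one, Real.rpow_one]
    refine tsum_congr fun n => ?_
    rw [Real.rpow_one, sub_apply, Real.norm_eq_abs]
    change |(n : ℝ) * f n - n * g n| = _
    rw [← mul_sub, abs_mul, Nat.abs_cast]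

instance : CompleteSpace X := toLp.completeSpace

/-- Multiplication by a bounded sequence. -/
noncomputable def mulL (w : ℕ+ → ℝ) (c : ℝ) (hw : ∀ n, |w n| ≤ c) : X →L[ℝ] X :=
  LinearMap.mkContinuous
    { toFun := fun f => mk (fun n => w n * f n) ((f.memX.smul c).of_le fun n => by
        simp only [Pi.smul_apply, smul_eq_mul, abs_mul]
        exact mul_le_mul_of_nonneg_right ((hw n).trans (le_abs_self c)) (abs_nonneg _))
      map_add' := fun f g => by ext n; simp [mul_add]
      map_smul' := fun c f => by ext n; simp; ring } c fun f => norm_le_mul_norm fun n => by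
        simpa [abs_mul] using mul_le_mul_of_nonneg_right (hw n) (abs_nonneg _)

@[simp] theorem mulL_apply (w : ℕ+ → ℝ) (c : ℝ) (hw : ∀ n, |w n| ≤ c) (f : X) (n : ℕ+) :
    mulL w c hw f n = w n * f n := rfl

theorem tsum_shift_le {g : ℕ+ → ℝ} (hg : MemX g) :
    ∑' n : ℕ+, (n : ℝ) * |g (n + 1)| ≤ ∑' n : ℕ+, (n : ℝ) * |g n| := by
  have hinj : Function.Injective fun n : ℕ+ => n + 1 := fun m n hmn => add_right_cancel hmn
  refine Summable.tsum_le_tsum_of_inj (fun n : ℕ+ => n + 1) hinj (fun n _ => by positivity)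
    (fun n => ?_) hg.shift hg
  refine mul_le_mul_of_nonneg_right ?_ (abs_nonneg _)
  push_cast
  linarith

/-- The left shift `f ↦ (f_{n+1})_n`. -/
noncomputable def shiftL : X →L[ℝ] X :=
  LinearMap.mkContinuous
    { toFun := fun f => mk (fun n => f (n + 1)) f.memX.shift
      map_add' := fun _ _ => rfl
      map_smul' := fun _ _ => rfl } 1 fun f => by
        rw [one_mul]
        exact tsum_shift_le f.memX

@[simp] theorem shiftL_apply (f : X) (n : ℕ+) : shiftL f n = f (n + 1) := rfl

theorem norm_shiftL_le (f : X) : ‖shiftL f‖ ≤ ‖f‖ := tsum_shift_le f.memX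

theorem Nonneg.of_tendsto {ι : Type*} {l : Filter ι} [l.NeBot] {u : ι → X} {f : X}
    (hu : Tendsto u l (𝓝 f)) (h : ∀ i, Nonneg (u i)) : Nonneg f := fun n =>
  ge_of_tendsto' (f := fun i => u i n) (((coordL n).continuous.tendsto f).comp hu) fun i => h i n

/-- The truncation `f ↦ (f_1, …, f_N, 0, 0, …)`. -/
noncomputable def truncL (N : ℕ) : X →L[ℝ] X :=
  mulL (fun n => if (n : ℕ) ≤ N then 1 else 0) 1 fun n => by split_ifs <;> simp

theorem truncL_apply (N : ℕ) (f : X) (n : ℕ+) :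
    truncL N f n = if (n : ℕ) ≤ N then f n else 0 := by
  simp [truncL]

theorem tendsto_truncL (f : X) : Tendsto (fun N => truncL N f) atTop (𝓝 f) := by
  rw [tendsto_iff_norm_sub_tendsto_zero]
  simp only [norm_def]
  have h0 : (0 : ℝ) = ∑' n : ℕ+, (0 : ℝ) := by simp
  rw [h0]
  refine tendsto_tsum_of_dominated_convergence (bound := fun n : ℕ+ => (n : ℝ) * |f n|) f.memX
    (fun n => ?_) (Eventually.of_forall fun N n => ?_)
  · refine tendsto_const_nhds.congr' ?_
    filter_upwards [eventually_ge_atTop (n : ℕ)] with N hN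
    simp [truncL_apply, hN]
  · rw [sub_apply, truncL_apply, Real.norm_eq_abs, abs_mul, abs_abs, Nat.abs_cast]
    split_ifs <;> simp

end X

/-! ### Exponentials of bounded A with A + c positive and ‖A + c‖ ≤ c -/

section BoundedGenerator

variable {A : X →L[ℝ] X} {c : ℝ}

/-- Scalars commute with everything. A itself is not positive because of its diagonal, but A + c can
be, so positivity and contractivity are read off from the right-hand side. -/
theorem exp_smul_eq (A : X →L[ℝ] X) (c t : ℝ) :
    exp (t • A) = Real.exp (-(t * c)) • exp (t • (A + c • (1 : X →L[ℝ] X))) := by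
  let _ : NormedAlgebra ℚ (X →L[ℝ] X) := NormedAlgebra.restrictScalars ℚ ℝ _
  have h : t • A = algebraMap ℝ (X →L[ℝ] X) (-(t * c)) + t • (A + c • (1 : X →L[ℝ] X)) := by
    rw [Algebra.algebraMap_eq_smul_one]
    module
  rw [h, exp_add_of_commute (Algebra.commutes _ _), ← algebraMap_exp_comm, ← Algebra.smul_def,
    Real.exp_eq_exp_ℝ]

theorem exp_apply_nonneg {B : X →L[ℝ] X} (hB : ∀ f, X.Nonneg f → X.Nonneg (B f)) {f : X}
    (hf : X.Nonneg f) : X.Nonneg (exp B f) := by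
  have hpow : ∀ k : ℕ, X.Nonneg ((B ^ k) f) := by
    intro k
    induction k with
    | zero => simpa using hf
    | succ k ih => rw [pow_succ']; exact hB _ ih
  have hs := ((exp_series_hasSum_exp' (𝕂 := ℝ) B).mapL (ContinuousLinearMap.apply ℝ X f))
  intro n
  refine HasSum.nonneg (fun k => ?_) (show HasSum _ (exp B f n) from hs.mapL (X.coordL n))
  have := hpow k n
  simp only [ContinuousLinearMap.apply_apply, X.coordL_apply, _root_.smul_apply,
    X.smul_apply]
  positivity

theorem exp_smul_nonneg (hA : ∀ f, X.Nonneg f → X.Nonneg ((A + c • (1 : X →L[ℝ] X)) f)) {t : ℝ}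
    (ht : 0 ≤ t) {f : X} (hf : X.Nonneg f) : X.Nonneg (exp (t • A) f) := by
  rw [exp_smul_eq A c t]
  intro n
  refine mul_nonneg (Real.exp_pos _).le (exp_apply_nonneg (fun g hg m => ?_) hf n)
  exact mul_nonneg ht (hA g hg m)

theorem norm_exp_le_exp_norm (B : X →L[ℝ] X) (f : X) : ‖exp B f‖ ≤ Real.exp ‖B‖ * ‖f‖ := by
  have hs := ((exp_series_hasSum_exp' (𝕂 := ℝ) B).mapL (ContinuousLinearMap.apply ℝ X f))
  have hr : HasSum (fun k : ℕ => ((k.factorial : ℝ)⁻¹ * ‖B‖ ^ k) * ‖f‖) (Real.exp ‖B‖ * ‖f‖) := by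
    rw [Real.exp_eq_exp_ℝ]
    exact (exp_series_hasSum_exp' (𝕂 := ℝ) ‖B‖).mul_right _
  have hpow : ∀ k : ℕ, ‖(B ^ k) f‖ ≤ ‖B‖ ^ k * ‖f‖ := by
    intro k
    induction k with
    | zero => simp
    | succ k ih =>
      rw [pow_succ', pow_succ', mul_assoc]
      exact (B.le_opNorm _).trans (mul_le_mul_of_nonneg_left ih (norm_nonneg _))
  rw [← (show _ = exp B f from hs.tsum_eq)]
  refine tsum_of_norm_bounded hr fun k => ?_
  simp only [ContinuousLinearMap.apply_apply, _root_.smul_apply]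
  rw [norm_smul, norm_inv, RCLike.norm_natCast, mul_assoc]
  exact mul_le_mul_of_nonneg_left (hpow k) (by positivity)

/-- The factor exp(-tc) exactly cancels the bound exp(tc) for the exponential of t(A + c). -/
theorem norm_exp_smul_le (hA : ‖A + c • (1 : X →L[ℝ] X)‖ ≤ c) {t : ℝ} (ht : 0 ≤ t) (f : X) :
    ‖exp (t • A) f‖ ≤ ‖f‖ := by
  rw [exp_smul_eq A c t, _root_.smul_apply, norm_smul, Real.norm_eq_abs,
    Real.abs_exp]
  have h1 : ‖t • (A + c • (1 : X →L[ℝ] X))‖ ≤ t * c := by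
    rw [norm_smul, Real.norm_eq_abs, abs_of_nonneg ht]
    exact mul_le_mul_of_nonneg_left hA ht
  calc _ ≤ Real.exp (-(t * c)) * (Real.exp (t * c) * ‖f‖) := by
        refine mul_le_mul_of_nonneg_left ((norm_exp_le_exp_norm _ f).trans ?_) (Real.exp_pos _).le
        exact mul_le_mul_of_nonneg_right (Real.exp_le_exp.2 h1) (norm_nonneg _)
    _ = ‖f‖ := by rw [← mul_assoc, ← Real.exp_add]; simp

theorem hasDerivAt_exp_smul_apply (A : X →L[ℝ] X) (f : X) (t : ℝ) :
    HasDerivAt (fun s : ℝ => exp (s • A) f) (exp (t • A) (A f)) t :=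
  (ContinuousLinearMap.apply ℝ X f).hasFDerivAt.comp_hasDerivAt t (hasDerivAt_exp_smul_const A t)

theorem norm_exp_smul_sub_le (hA : ‖A + c • (1 : X →L[ℝ] X)‖ ≤ c) {t : ℝ} (ht : 0 ≤ t) (f : X) :
    ‖exp (t • A) f - f‖ ≤ t * ‖A f‖ := by
  have := norm_image_sub_le_of_norm_deriv_le_segment' (a := 0) (b := t) (C := ‖A f‖)
    (fun s _ => (hasDerivAt_exp_smul_apply A f s).hasDerivWithinAt)
    (fun s hs => norm_exp_smul_le hA hs.1 _) t ⟨ht, le_rfl⟩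
  simpa [mul_comm] using this

/-- The derivative of s ↦ exp(sA)f - sAf is (exp(sA) - 1)Af. Replacing Af by a nearby z avoids A²f
and the operator norm of A, so the estimate stays uniform along the truncations when z is a fixed
finitely supported vector. -/
theorem norm_exp_smul_sub_sub_le (hA : ‖A + c • (1 : X →L[ℝ] X)‖ ≤ c) {t : ℝ} (ht : 0 ≤ t)
    (f z : X) :
    ‖exp (t • A) f - f - t • A f‖ ≤ t * (2 * ‖A f - z‖ + t * ‖A z‖) := by
  have hd : ∀ s : ℝ, HasDerivAt (fun s : ℝ => exp (s • A) f - s • A f)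
      (exp (s • A) (A f) - A f) s := fun s => by
    have h := (hasDerivAt_exp_smul_apply A f s).sub ((hasDerivAt_id s).smul_const (A f))
    rw [one_smul] at h
    exact h
  have := norm_image_sub_le_of_norm_deriv_le_segment' (a := 0) (b := t)
    (C := 2 * ‖A f - z‖ + t * ‖A z‖)
    (fun s _ => (hd s).hasDerivWithinAt) (fun s hs => ?_) t ⟨ht, le_rfl⟩
  · have e : exp (t • A) f - f - t • A f = exp (t • A) f - t • A f - f := by abel
    simpa [mul_comm, e] using this
  · have e : exp (s • A) (A f) - A f
        = exp (s • A) (A f - z) + (exp (s • A) z - z) - (A f - z) := by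
      rw [map_sub]; abel
    rw [e]
    have h1 := norm_exp_smul_le hA hs.1 (A f - z)
    have h2 := norm_exp_smul_sub_le hA hs.1 z
    have h3 : s * ‖A z‖ ≤ t * ‖A z‖ := mul_le_mul_of_nonneg_right hs.2.le (norm_nonneg _)
    have h4 := norm_sub_le (exp (s • A) (A f - z) + (exp (s • A) z - z)) (A f - z)
    have h5 := norm_add_le (exp (s • A) (A f - z)) (exp (s • A) z - z)
    linarith

end BoundedGenerator

/-! ### Finite truncations of the decay operator -/

/-- The bound `∑_{k ≤ N} |w_k|` for the truncation of `w` to `{1, …, N}`. -/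
noncomputable def truncBound (w : ℕ+ → ℝ) (N : ℕ) : ℝ := ∑ k ∈ Finset.range N, |w k.succPNat|

theorem abs_le_truncBound (w : ℕ+ → ℝ) {N : ℕ} {n : ℕ+} (hn : (n : ℕ) ≤ N) :
    |w n| ≤ truncBound w N := by
  have h1 : n.natPred ∈ Finset.range N := by
    have := n.natPred_add_one
    simp only [Finset.mem_range]
    omega
  have := Finset.single_le_sum (f := fun k : ℕ => |w k.succPNat|) (fun k _ => abs_nonneg _) h1
  rw [PNat.succPNat_natPred] at this
  exact this

theorem truncBound_nonneg (w : ℕ+ → ℝ) (N : ℕ) : 0 ≤ truncBound w N :=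
  Finset.sum_nonneg fun _ _ => abs_nonneg _

/-- The truncation of the sequence `w` to `{1, …, N}`. -/
noncomputable def truncSeq (w : ℕ+ → ℝ) (N : ℕ) (n : ℕ+) : ℝ := if (n : ℕ) ≤ N then w n else 0

theorem abs_truncSeq_le (w : ℕ+ → ℝ) (N : ℕ) (n : ℕ+) : |truncSeq w N n| ≤ truncBound w N := by
  unfold truncSeq
  split_ifs with hn
  · exact abs_le_truncBound w hn
  · simpa using truncBound_nonneg w N

/-- The operator `f ↦ (r_{n+1} f_{n+1} - θ_n f_n)_n` applied after truncation to `{1, …, N}`. -/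
noncomputable def truncGen (r θ : ℕ+ → ℝ) (N : ℕ) : X →L[ℝ] X :=
  X.shiftL.comp (X.mulL (truncSeq r N) _ (abs_truncSeq_le r N)) -
    X.mulL (truncSeq θ N) _ (abs_truncSeq_le θ N)

section Truncation

variable {r θ : ℕ+ → ℝ}

theorem truncGen_apply (r θ : ℕ+ → ℝ) (N : ℕ) (f : X) (n : ℕ+) :
    truncGen r θ N f n = truncSeq r N (n + 1) * f (n + 1) - truncSeq θ N n * f n := rfl

theorem truncGen_mul_truncL (r θ : ℕ+ → ℝ) {M N : ℕ} (h : M ≤ N) :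
    truncGen r θ N * X.truncL M = truncGen r θ M := by
  ext f n
  change truncGen r θ N (X.truncL M f) n = _
  simp only [truncGen_apply, X.truncL_apply, truncSeq]
  split_ifs <;> first | omega | simp

theorem truncL_mul_truncGen (r θ : ℕ+ → ℝ) (M : ℕ) :
    X.truncL M * truncGen r θ M = truncGen r θ M := by
  ext f n
  change X.truncL M (truncGen r θ M f) n = _
  simp only [truncGen_apply, X.truncL_apply, truncSeq]
  have hn : ((n + 1 : ℕ+) : ℕ) = n + 1 := rfl
  split_ifs <;> first | omega | simp

theorem exp_mul_of_mul_eq {B C P : X →L[ℝ] X} (h : B * P = P * C) : exp B * P = P * exp C := by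
  have hpow : ∀ k : ℕ, B ^ k * P = P * C ^ k := by
    intro k
    induction k with
    | zero => simp
    | succ k ih => rw [pow_succ, mul_assoc, h, ← mul_assoc, ih, mul_assoc, ← pow_succ]
  have h1 := (exp_series_hasSum_exp' (𝕂 := ℝ) B).mul_right P
  have h2 := (exp_series_hasSum_exp' (𝕂 := ℝ) C).mul_left P
  refine h1.unique (h2.congr_fun fun k => ?_)
  rw [smul_mul_assoc, mul_smul_comm, hpow]

/-- Decay only lowers the index, so sequences supported in {1, …, M} form an invariant subspace on
which the N-th and M-th truncations coincide. The right-hand side does not depend on N; this is what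
makes the exponentials converge. -/
theorem exp_truncGen_truncL (r θ : ℕ+ → ℝ) {M N : ℕ} (h : M ≤ N) (t : ℝ) (f : X) :
    exp (t • truncGen r θ N) (X.truncL M f) = X.truncL M (exp (t • truncGen r θ M) f) := by
  have : exp (t • truncGen r θ N) * X.truncL M = X.truncL M * exp (t • truncGen r θ M) :=
    exp_mul_of_mul_eq (by
      rw [smul_mul_assoc, mul_smul_comm, truncGen_mul_truncL r θ h, truncL_mul_truncGen])
  exact congrArg (fun B : X →L[ℝ] X => B f) this

theorem truncGen_add_apply (N : ℕ) (f : X) (n : ℕ+) :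
    (truncGen r θ N + truncBound θ N • (1 : X →L[ℝ] X)) f n =
      truncSeq r N (n + 1) * f (n + 1) + (truncBound θ N - truncSeq θ N n) * f n := by
  change truncGen r θ N f n + truncBound θ N * f n = _
  rw [truncGen_apply]
  ring

theorem truncGen_add_nonneg (hr : ∀ n, 0 ≤ r n) (N : ℕ) (f : X) (hf : X.Nonneg f) :
    X.Nonneg ((truncGen r θ N + truncBound θ N • (1 : X →L[ℝ] X)) f) := by
  intro n
  rw [truncGen_add_apply]
  have h1 : 0 ≤ truncSeq r N (n + 1) := by
    unfold truncSeq
    split_ifs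
    exacts [hr _, le_rfl]
  have h2 := (le_abs_self _).trans (abs_truncSeq_le θ N n)
  have h3 := hf n
  have h4 := hf (n + 1)
  have h5 := sub_nonneg.2 h2
  positivity

/-- A column-sum estimate: f_n contributes at most r_n|f_n| through the shift, which does not
increase the weight, and (c - θ_n)|f_n| on the diagonal. The total is at most c|f_n| because r ≤ θ.
-/
theorem norm_truncGen_add_le (hr : ∀ n, 0 ≤ r n) (hrθ : ∀ n, r n ≤ θ n) (N : ℕ) :
    ‖truncGen r θ N + truncBound θ N • (1 : X →L[ℝ] X)‖ ≤ truncBound θ N := by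
  refine ContinuousLinearMap.opNorm_le_bound _ (truncBound_nonneg θ N) fun f => ?_
  set u : X := X.mulL (truncSeq r N) _ (abs_truncSeq_le r N) f
  set v : X := truncBound θ N • f - X.mulL (truncSeq θ N) _ (abs_truncSeq_le θ N) f
  have e : (truncGen r θ N + truncBound θ N • (1 : X →L[ℝ] X)) f = X.shiftL u + v := by
    ext n
    rw [truncGen_add_apply]
    simp only [u, v, X.add_apply, X.sub_apply, X.shiftL_apply, X.mulL_apply, X.smul_apply]
    ring
  rw [e]
  refine (norm_add_le _ _).trans ((add_le_add_left (X.norm_shiftL_le u) _).trans ?_)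
  refine X.norm_add_norm_le fun n => ?_
  have hv : v n = (truncBound θ N - truncSeq θ N n) * f n := by
    simp only [v, X.sub_apply, X.mulL_apply, X.smul_apply]
    ring
  have h2 := (le_abs_self _).trans (abs_truncSeq_le θ N n)
  have h3 : 0 ≤ truncSeq r N n ∧ truncSeq r N n ≤ truncSeq θ N n := by
    unfold truncSeq
    split_ifs
    exacts [⟨hr _, hrθ _⟩, ⟨le_rfl, le_rfl⟩]
  rw [hv, X.mulL_apply, abs_mul, abs_mul, abs_of_nonneg h3.1, abs_of_nonneg (sub_nonneg.2 h2)]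
  nlinarith [abs_nonneg (f n), h3.2]

theorem tendsto_truncGen {f u v g : X} (hu : ∀ n, u n = θ n * f n) (hv : ∀ n, v n = r n * f n)
    (hg : ∀ n, g n = r (n + 1) * f (n + 1) - θ n * f n) :
    Tendsto (fun N => truncGen r θ N f) atTop (𝓝 g) := by
  have e : g = X.shiftL v - u := by
    ext n
    rw [hg, X.sub_apply, X.shiftL_apply, hu, hv]
  rw [e]
  refine (((X.shiftL.continuous.tendsto v).comp (X.tendsto_truncL v)).sub
    (X.tendsto_truncL u)).congr fun N => ?_
  ext n
  simp only [Function.comp_apply, X.sub_apply, X.shiftL_apply, X.truncL_apply, truncGen_apply,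
    truncSeq, hu, hv]
  split_ifs <;> simp

/-! ### The limit semigroup and its generator -/

/-- The exponentials of the truncated operators converge strongly. -/
theorem exists_tendsto_exp_truncGen (hr : ∀ n, 0 ≤ r n) (hrθ : ∀ n, r n ≤ θ n) :
    ∃ S : ℝ≥0 → X →L[ℝ] X,
      ∀ (t : ℝ≥0) f, Tendsto (fun N => exp ((t : ℝ) • truncGen r θ N) f) atTop (𝓝 (S t f)) := by
  have key : ∀ (t : ℝ≥0) (f : X), ∃ g, Tendsto (fun N => exp ((t : ℝ) • truncGen r θ N) f)
      atTop (𝓝 g) := by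
    intro t f
    refine cauchySeq_tendsto_of_complete (Metric.cauchySeq_iff'.2 fun ε hε => ?_)
    obtain ⟨M, hM⟩ := ((tendsto_iff_norm_sub_tendsto_zero.1 (X.tendsto_truncL f)).eventually_lt_const
      (show (0 : ℝ) < ε / 2 by positivity)).exists
    refine ⟨M, fun N hN => ?_⟩
    -- The N-th and M-th exponentials send the truncation of f to the same vector, so only the tail
    -- of f, of norm below ε/2, contributes to each.
    have h1 := norm_exp_smul_le (norm_truncGen_add_le hr hrθ N) t.2 (f - X.truncL M f)
    have h2 := norm_exp_smul_le (norm_truncGen_add_le hr hrθ M) t.2 (f - X.truncL M f)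
    rw [map_sub, exp_truncGen_truncL r θ hN] at h1
    rw [map_sub, exp_truncGen_truncL r θ le_rfl] at h2
    rw [norm_sub_rev] at hM
    rw [dist_eq_norm]
    have h3 := norm_sub_le
      (exp ((t : ℝ) • truncGen r θ N) f - X.truncL M (exp ((t : ℝ) • truncGen r θ M) f))
      (exp ((t : ℝ) • truncGen r θ M) f - X.truncL M (exp ((t : ℝ) • truncGen r θ M) f))
    rw [sub_sub_sub_cancel_right] at h3
    refine h3.trans_lt ?_
    have h4 := h1.trans_lt hM
    have h5 := h2.trans_lt hM
    linarith! [h4, h5]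
  choose S hS using key
  refine ⟨fun t => LinearMap.mkContinuous (linearMapOfTendsto (S t)
    (fun N => (exp ((t : ℝ) • truncGen r θ N)).toLinearMap) (tendsto_pi_nhds.2 (hS t))) 1
    fun f => ?_, hS⟩
  rw [one_mul]
  exact le_of_tendsto (hS t f).norm (Eventually.of_forall fun N =>
    norm_exp_smul_le (norm_truncGen_add_le hr hrθ N) t.2 f)

variable {S : ℝ≥0 → X →L[ℝ] X}

/-- The bound holds for every exponential with N ≥ M and does not involve N, so it survives the
limit; it yields strong continuity at 0. -/
theorem norm_limit_sub_le (hr : ∀ n, 0 ≤ r n) (hrθ : ∀ n, r n ≤ θ n)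
    (hS : ∀ (t : ℝ≥0) f, Tendsto (fun N => exp ((t : ℝ) • truncGen r θ N) f) atTop (𝓝 (S t f)))
    (t : ℝ≥0) (f : X) (M : ℕ) :
    ‖S t f - f‖ ≤ 2 * ‖f - X.truncL M f‖ + t * ‖truncGen r θ M f‖ := by
  refine le_of_tendsto ((hS t f).sub_const f).norm ?_
  filter_upwards [eventually_ge_atTop M] with N hN
  have h1 := norm_exp_smul_le (norm_truncGen_add_le hr hrθ N) t.2 (f - X.truncL M f)
  have h2 := norm_exp_smul_sub_le (norm_truncGen_add_le hr hrθ N) t.2 (X.truncL M f)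
  have h3 : truncGen r θ N (X.truncL M f) = truncGen r θ M f :=
    congrArg (fun B : X →L[ℝ] X => B f) (truncGen_mul_truncL r θ hN)
  rw [h3] at h2
  have e : exp ((t : ℝ) • truncGen r θ N) f - f = exp ((t : ℝ) • truncGen r θ N) (f - X.truncL M f)
      + (exp ((t : ℝ) • truncGen r θ N) (X.truncL M f) - X.truncL M f) - (f - X.truncL M f) := by
    rw [map_sub]; abel
  rw [e]
  refine (norm_sub_le _ _).trans ((add_le_add_left (norm_add_le _ _) _).trans ?_)
  linarith! [h1, h2]

theorem isSubstochasticSemigroup_of_tendsto (hr : ∀ n, 0 ≤ r n) (hrθ : ∀ n, r n ≤ θ n)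
    (hS : ∀ (t : ℝ≥0) f, Tendsto (fun N => exp ((t : ℝ) • truncGen r θ N) f) atTop (𝓝 (S t f))) :
    IsSubstochasticSemigroup S where
  map_zero := by
    ext1 f
    refine tendsto_nhds_unique (hS 0 f) (tendsto_const_nhds.congr fun N => ?_)
    simp
  map_add s t := by
    ext1 f
    refine tendsto_nhds_unique (hS (s + t) f) ?_
    let _ : NormedAlgebra ℚ (X →L[ℝ] X) := NormedAlgebra.restrictScalars ℚ ℝ _
    -- Uniform contractivity allows the strong limit of a product to be taken factor by factor.
    have h0 : Tendsto (fun N => exp ((s : ℝ) • truncGen r θ N)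
        (exp ((t : ℝ) • truncGen r θ N) f - S t f)) atTop (𝓝 0) :=
      squeeze_zero_norm
        (fun N => norm_exp_smul_le (norm_truncGen_add_le hr hrθ N) s.2 _)
        (tendsto_iff_norm_sub_tendsto_zero.1 (hS t f))
    have h1 := h0.add (hS s (S t f))
    rw [zero_add] at h1
    refine h1.congr fun N => ?_
    rw [NNReal.coe_add, add_smul, exp_add_of_commute
      ((Commute.refl (truncGen r θ N)).smul_left _ |>.smul_right _), ← map_add, sub_add_cancel]
    rfl
  tendsto_zero f := by
    rw [tendsto_iff_norm_sub_tendsto_zero]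
    refine Metric.tendsto_nhds.2 fun ε hε => ?_
    obtain ⟨M, hM⟩ := ((tendsto_iff_norm_sub_tendsto_zero.1 (X.tendsto_truncL f)).eventually_lt_const
      (show (0 : ℝ) < ε / 4 by positivity)).exists
    have hc : Tendsto (fun t : ℝ≥0 => (t : ℝ) * ‖truncGen r θ M f‖) (𝓝 0) (𝓝 0) := by
      have : Continuous fun t : ℝ≥0 => (t : ℝ) * ‖truncGen r θ M f‖ := by fun_prop
      simpa using this.tendsto 0
    filter_upwards [hc.eventually_lt_const (show (0 : ℝ) < ε / 2 by positivity)] with t ht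
    have := norm_limit_sub_le hr hrθ hS t f M
    rw [norm_sub_rev] at hM
    rw [dist_zero_right, norm_norm]
    linarith
  nonneg t f hf := X.Nonneg.of_tendsto (hS t f) fun N =>
    exp_smul_nonneg (truncGen_add_nonneg hr N) t.2 hf
  contraction t f := le_of_tendsto (hS t f).norm (Eventually.of_forall fun N =>
    norm_exp_smul_le (norm_truncGen_add_le hr hrθ N) t.2 f)

/-- Limit in N of `norm_exp_smul_sub_sub_le` with z the M-th truncation of g. After division by t,
the bound is small once M is chosen large and then t small. -/
theorem norm_limit_sub_sub_le (hr : ∀ n, 0 ≤ r n) (hrθ : ∀ n, r n ≤ θ n)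
    (hS : ∀ (t : ℝ≥0) f, Tendsto (fun N => exp ((t : ℝ) • truncGen r θ N) f) atTop (𝓝 (S t f)))
    {f g : X} (hg : Tendsto (fun N => truncGen r θ N f) atTop (𝓝 g)) (t : ℝ≥0) (M : ℕ) :
    ‖S t f - f - (t : ℝ) • g‖ ≤ t * (2 * ‖g - X.truncL M g‖ + t * ‖truncGen r θ M g‖) := by
  have hP := X.tendsto_truncL f
  have h0 : Tendsto (fun N => exp ((t : ℝ) • truncGen r θ N) (X.truncL N f - f)) atTop (𝓝 0) :=
    squeeze_zero_norm
      (fun N => norm_exp_smul_le (norm_truncGen_add_le hr hrθ N) t.2 _)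
      (tendsto_iff_norm_sub_tendsto_zero.1 hP)
  have h1 : Tendsto (fun N => exp ((t : ℝ) • truncGen r θ N) (X.truncL N f)) atTop
      (𝓝 (S t f)) := by
    have := h0.add (hS t f)
    rw [zero_add] at this
    exact this.congr fun N => by rw [← map_add, sub_add_cancel]
  refine le_of_tendsto_of_tendsto ((h1.sub hP).sub (hg.const_smul (t : ℝ))).norm
    ((((hg.sub_const (X.truncL M g)).norm.const_mul 2).add_const
      ((t : ℝ) * ‖truncGen r θ M g‖)).const_mul (t : ℝ)) ?_
  filter_upwards [eventually_ge_atTop M] with N hN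
  have h2 := norm_exp_smul_sub_sub_le (norm_truncGen_add_le hr hrθ N) t.2 (X.truncL N f)
    (X.truncL M g)
  have h3 : truncGen r θ N (X.truncL M g) = truncGen r θ M g :=
    congrArg (fun B : X →L[ℝ] X => B g) (truncGen_mul_truncL r θ hN)
  have h4 : truncGen r θ N (X.truncL N f) = truncGen r θ N f :=
    congrArg (fun B : X →L[ℝ] X => B f) (truncGen_mul_truncL r θ le_rfl)
  rw [h3, h4] at h2
  exact h2

theorem tendsto_inv_smul_limit_sub (hr : ∀ n, 0 ≤ r n) (hrθ : ∀ n, r n ≤ θ n)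
    (hS : ∀ (t : ℝ≥0) f, Tendsto (fun N => exp ((t : ℝ) • truncGen r θ N) f) atTop (𝓝 (S t f)))
    {f g : X} (hg : Tendsto (fun N => truncGen r θ N f) atTop (𝓝 g)) :
    Tendsto (fun t : ℝ≥0 => (t : ℝ)⁻¹ • (S t f - f)) (𝓝[>] 0) (𝓝 g) := by
  rw [tendsto_iff_norm_sub_tendsto_zero]
  refine Metric.tendsto_nhds.2 fun ε hε => ?_
  obtain ⟨M, hM⟩ := ((tendsto_iff_norm_sub_tendsto_zero.1 (X.tendsto_truncL g)).eventually_lt_const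
    (show (0 : ℝ) < ε / 4 by positivity)).exists
  have hc : Tendsto (fun t : ℝ≥0 => (t : ℝ) * ‖truncGen r θ M g‖) (𝓝 0) (𝓝 0) := by
    have : Continuous fun t : ℝ≥0 => (t : ℝ) * ‖truncGen r θ M g‖ := by fun_prop
    simpa using this.tendsto 0
  filter_upwards [(hc.mono_left nhdsWithin_le_nhds).eventually_lt_const
    (show (0 : ℝ) < ε / 2 by positivity), self_mem_nhdsWithin] with t ht ht0
  have ht1 : (0 : ℝ) < t := ht0
  have h1 := norm_limit_sub_sub_le hr hrθ hS hg t M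
  have e : (t : ℝ)⁻¹ • (S t f - f) - g = (t : ℝ)⁻¹ • (S t f - f - (t : ℝ) • g) := by
    rw [smul_sub _ _ ((t : ℝ) • g), inv_smul_smul₀ ht1.ne']
  rw [norm_sub_rev] at hM
  rw [dist_zero_right, norm_norm, e, norm_smul, norm_inv, Real.norm_eq_abs, abs_of_pos ht1,
    inv_mul_lt_iff₀ ht1]
  refine h1.trans_lt (mul_lt_mul_of_pos_left ?_ ht1)
  linarith

end Truncation

/-! ### Contraction semigroups: dissipativity, uniqueness, maximality of generators -/

section Semigroup

variable {S S' : ℝ≥0 → X →L[ℝ] X}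

/-- Generators of contraction semigroups are dissipative. -/
theorem IsSubstochasticSemigroup.norm_le_norm_sub (hS : IsSubstochasticSemigroup S) {f g : X}
    (hg : Tendsto (fun t : ℝ≥0 => (t : ℝ)⁻¹ • (S t f - f)) (𝓝[>] 0) (𝓝 g)) :
    ‖f‖ ≤ ‖f - g‖ := by
  refine ge_of_tendsto (hg.const_sub f).norm ?_
  filter_upwards [self_mem_nhdsWithin] with t ht
  have ht1 : (0 : ℝ) < t := ht
  have e : f - (t : ℝ)⁻¹ • (S t f - f) = (1 + (t : ℝ)⁻¹) • f - (t : ℝ)⁻¹ • S t f := by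
    module
  have h1 := norm_sub_norm_le ((1 + (t : ℝ)⁻¹) • f) ((t : ℝ)⁻¹ • S t f)
  have hi : 0 < (t : ℝ)⁻¹ := inv_pos.2 ht1
  rw [norm_smul, norm_smul, Real.norm_eq_abs, Real.norm_eq_abs, abs_of_pos hi,
    abs_of_pos (by positivity)] at h1
  have h2 := mul_le_mul_of_nonneg_left (hS.contraction t f) hi.le
  rw [e]
  linarith

theorem IsSubstochasticSemigroup.comm (hS : IsSubstochasticSemigroup S) (s t : ℝ≥0) (f : X) :
    S s (S t f) = S t (S s f) := by
  have h1 := hS.map_add s t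
  rw [add_comm, hS.map_add t s] at h1
  exact (congrArg (fun B : X →L[ℝ] X => B f) h1).symm

theorem IsSubstochasticSemigroup.map_add_apply (hS : IsSubstochasticSemigroup S) (s t : ℝ≥0)
    (f : X) : S (s + t) f = S s (S t f) :=
  congrArg (fun B : X →L[ℝ] X => B f) (hS.map_add s t)

theorem IsSubstochasticSemigroup.continuous (hS : IsSubstochasticSemigroup S) (f : X) :
    Continuous fun t => S t f := by
  have key : ∀ s t : ℝ≥0, s ≤ t → ‖S t f - S s f‖ ≤ ‖S (t - s) f - f‖ := fun s t h => by
    have : S t f = S s (S (t - s) f) := by rw [← hS.map_add_apply, add_tsub_cancel_of_le h]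
    rw [this, ← map_sub]
    exact hS.contraction _ _
  refine continuous_iff_continuousAt.2 fun s => tendsto_iff_norm_sub_tendsto_zero.2 ?_
  -- Subtraction in `ℝ≥0` is truncated, so this sum is |t - s|.
  have h1 : Tendsto (fun t : ℝ≥0 => (t - s) + (s - t)) (𝓝 s) (𝓝 0) := by
    have : Continuous fun t : ℝ≥0 => (t - s) + (s - t) := by fun_prop
    simpa using this.tendsto s
  have h2 := tendsto_iff_norm_sub_tendsto_zero.1 ((hS.tendsto_zero f).comp h1)
  refine squeeze_zero (fun _ => norm_nonneg _) (fun t => ?_) h2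
  rcases le_total s t with h | h
  · simpa [tsub_eq_zero_of_le h] using key s t h
  · rw [norm_sub_rev]
    simpa [tsub_eq_zero_of_le h] using key t s h

/-- The domain of the generator is invariant under the semigroup. -/
theorem IsSubstochasticSemigroup.tendsto_apply (hS : IsSubstochasticSemigroup S) {f g : X}
    (hg : Tendsto (fun t : ℝ≥0 => (t : ℝ)⁻¹ • (S t f - f)) (𝓝[>] 0) (𝓝 g)) (s : ℝ≥0) :
    Tendsto (fun t : ℝ≥0 => (t : ℝ)⁻¹ • (S t (S s f) - S s f)) (𝓝[>] 0) (𝓝 (S s g)) := by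
  refine (((S s).continuous.tendsto g).comp hg).congr fun t => ?_
  rw [Function.comp_apply, map_smul, map_sub, hS.comm s t]

/-- Two contraction semigroups with the same generator agree on its domain. -/
theorem IsSubstochasticSemigroup.eq_of_isGenerator (hS : IsSubstochasticSemigroup S)
    (hS' : IsSubstochasticSemigroup S') {K : X →ₗ.[ℝ] X} (hK : IsGenerator S K)
    (hK' : IsGenerator S' K) {f : X} (hf : f ∈ K.domain) (t : ℝ≥0) : S t f = S' t f := by
  obtain ⟨g, hg⟩ : ∃ g, (f, g) ∈ K.graph := ⟨K ⟨f, hf⟩, K.mem_graph ⟨f, hf⟩⟩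
  set φ : ℝ → ℝ := fun x => ‖S x.toNNReal f - S' x.toNNReal f‖ with hφ
  have hcont : Continuous φ :=
    (((hS.continuous f).comp continuous_real_toNNReal).sub
      ((hS'.continuous f).comp continuous_real_toNNReal)).norm
  -- The vector y = S'(x)f stays in D(K), where both semigroups have the same right derivative at 0.
  -- Past x the gap therefore grows by only o(z - x), the old gap being contracted by S. With φ(0) =
  -- 0 this forces φ ≤ 0.
  have hslope : ∀ x ∈ Set.Ico (0 : ℝ) t, ∀ ε, (0 : ℝ) < ε → ∃ᶠ z in 𝓝[>] x, slope φ x z < ε := by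
    intro x hx ε hε
    refine Eventually.frequently ?_
    set y := S' x.toNNReal f with hy
    have hyK : (y, S' x.toNNReal g) ∈ K.graph :=
      (hK' _ _).2 (hS'.tendsto_apply ((hK' _ _).1 hg) x.toNNReal)
    have h1 := ((hK _ _).1 hyK).sub ((hK' _ _).1 hyK)
    rw [sub_self] at h1
    have h2 : Tendsto (fun z : ℝ => (z - x).toNNReal) (𝓝[>] x) (𝓝[>] 0) := by
      refine tendsto_nhdsWithin_iff.2 ⟨?_, ?_⟩
      · have : Continuous fun z : ℝ => (z - x).toNNReal :=
          continuous_real_toNNReal.comp (by fun_prop)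
        simpa using (this.tendsto x).mono_left nhdsWithin_le_nhds
      · filter_upwards [self_mem_nhdsWithin] with z hz
        exact Real.toNNReal_pos.2 (sub_pos.2 hz)
    have h3 := (tendsto_zero_iff_norm_tendsto_zero.1 (h1.comp h2)).eventually_lt_const hε
    filter_upwards [h3, self_mem_nhdsWithin] with z hz hxz
    have hzx : 0 < z - x := sub_pos.2 hxz
    have hz0 : z.toNNReal = (z - x).toNNReal + x.toNNReal := by
      rw [← Real.toNNReal_add hzx.le hx.1, sub_add_cancel]
    rw [slope_def_field, div_lt_iff₀ hzx, sub_lt_iff_lt_add]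
    simp only [Function.comp_apply, Real.coe_toNNReal _ hzx.le] at hz
    rw [← smul_sub, norm_smul, norm_inv, Real.norm_eq_abs, abs_of_pos hzx,
      inv_mul_lt_iff₀ hzx, sub_sub_sub_cancel_right] at hz
    have e : S z.toNNReal f - S' z.toNNReal f =
        S (z - x).toNNReal (S x.toNNReal f - y) +
          (S (z - x).toNNReal y - S' (z - x).toNNReal y) := by
      rw [hz0, hS.map_add_apply, hS'.map_add_apply, map_sub]
      abel
    have h4 : φ z ≤ φ x + ‖S (z - x).toNNReal y - S' (z - x).toNNReal y‖ := by
      simp only [hφ]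
      rw [e]
      exact (norm_add_le _ _).trans (add_le_add_left (hS.contraction _ _) _)
    linarith
  have := image_le_of_liminf_slope_right_le_deriv_boundary (f := φ) (a := 0) (b := t)
    (B := fun _ => 0) (B' := fun _ => 0) hcont.continuousOn
    (by simp [hφ, hS.map_zero, hS'.map_zero]) continuousOn_const
    (fun x _ => hasDerivWithinAt_const _ _ _) hslope ⟨t.2, le_rfl⟩
  have h0 : ‖S t f - S' t f‖ ≤ 0 := by simpa [hφ] using this
  exact sub_eq_zero.1 (norm_le_zero_iff.1 h0)

/-- A generator of a contraction semigroup has no proper restriction `T` with `1 - T` onto. -/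
theorem IsSubstochasticSemigroup.mem_graph_of_surjective (hS : IsSubstochasticSemigroup S)
    {T : X →ₗ.[ℝ] X}
    (hT : ∀ f g, (f, g) ∈ T.graph →
      Tendsto (fun t : ℝ≥0 => (t : ℝ)⁻¹ • (S t f - f)) (𝓝[>] 0) (𝓝 g))
    (hsurj : ∀ y : X, ∃ f g, (f, g) ∈ T.graph ∧ f - g = y) {f g : X}
    (hg : Tendsto (fun t : ℝ≥0 => (t : ℝ)⁻¹ • (S t f - f)) (𝓝[>] 0) (𝓝 g)) :
    (f, g) ∈ T.graph := by
  -- The differences f - f' and g - g' are equal, so dissipativity gives ‖f - f'‖ ≤ 0.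
  obtain ⟨f', g', h', e⟩ := hsurj (f - g)
  have h1 : Tendsto (fun t : ℝ≥0 => (t : ℝ)⁻¹ • (S t (f - f') - (f - f'))) (𝓝[>] 0)
      (𝓝 (g - g')) := by
    refine (hg.sub (hT _ _ h')).congr fun t => ?_
    rw [map_sub, ← smul_sub, sub_sub_sub_comm]
  have h2 := hS.norm_le_norm_sub h1
  rw [sub_sub_sub_comm, e, sub_self, norm_zero, norm_le_zero_iff, sub_eq_zero] at h2
  subst h2
  rw [sub_right_inj] at e
  rwa [← e]

/-- If a generator `T` of a contraction semigroup has `1 - T` onto, then `T` is closed. -/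
theorem IsSubstochasticSemigroup.isClosed_of_surjective (hS : IsSubstochasticSemigroup S)
    {T : X →ₗ.[ℝ] X} (hT : IsGenerator S T)
    (hsurj : ∀ y : X, ∃ f g, (f, g) ∈ T.graph ∧ f - g = y) : T.IsClosed := by
  refine isClosed_of_closure_subset fun p hp => ?_
  obtain ⟨u, hu, hup⟩ := mem_closure_iff_seq_limit.1 hp
  obtain ⟨f', g', h', e⟩ := hsurj (p.1 - p.2)
  have hu1 : Tendsto (fun k => (u k).1) atTop (𝓝 p.1) := (continuous_fst.tendsto p).comp hup
  have hu2 : Tendsto (fun k => (u k).2) atTop (𝓝 p.2) := (continuous_snd.tendsto p).comp hup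
  -- Dissipativity passes to limits of graph points; the right-hand side vanishes by the choice of
  -- (f', g').
  have h1 : ‖p.1 - f'‖ ≤ ‖(p.1 - f') - (p.2 - g')‖ := by
    refine le_of_tendsto_of_tendsto' (hu1.sub_const f').norm
      ((hu1.sub_const f').sub (hu2.sub_const g')).norm fun k => ?_
    exact hS.norm_le_norm_sub ((hT _ _).1 (T.graph.sub_mem (hu k) h'))
  rw [sub_sub_sub_comm, e, sub_self, norm_zero, norm_le_zero_iff, sub_eq_zero] at h1
  have h2 : p.2 = g' := by rwa [h1, sub_right_inj, eq_comm] at e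
  have : p = (f', g') := Prod.ext h1 h2
  rw [this]
  exact h'

end Semigroup

/-! ### Surjectivity of 1 - (A₀ + A₁) -/

section Decay

variable {r a d : ℕ+ → ℝ}

theorem domain_A₀_add_A₁ (hr : ∀ n, 0 ≤ r n) (hrθ : ∀ n, r n ≤ theta r a d n) :
    (A₀ r a d + A₁ r).domain = (A₀ r a d).domain := by
  rw [LinearPMap.add_domain, inf_eq_left]
  intro f hf
  refine MemX.of_le hf fun n => ?_
  rw [abs_mul, abs_mul, abs_of_nonneg (hr n), abs_of_nonneg ((hr n).trans (hrθ n))]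
  exact mul_le_mul_of_nonneg_right (hrθ n) (abs_nonneg _)

theorem mem_graph_A₀_add_A₁ (hr : ∀ n, 0 ≤ r n) (hrθ : ∀ n, r n ≤ theta r a d n) {f g : X} :
    (f, g) ∈ (A₀ r a d + A₁ r).graph ↔ f ∈ mulDomain (theta r a d) ∧
      ∀ n, g n = r (n + 1) * f (n + 1) - theta r a d n * f n := by
  have hv : ∀ (x : (A₀ r a d + A₁ r).domain) (n : ℕ+), (A₀ r a d + A₁ r) x n =
      r (n + 1) * (x : X) (n + 1) - theta r a d n * (x : X) n := by
    intro x n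
    change -theta r a d n * (x : X) n + r (n + 1) * (x : X) (n + 1) = _
    ring
  rw [LinearPMap.mem_graph_iff]
  constructor
  · rintro ⟨x, hx, hg⟩
    dsimp only at hx hg
    subst hx hg
    exact ⟨(domain_A₀_add_A₁ hr hrθ).le x.2, hv x⟩
  · rintro ⟨hf, hg⟩
    refine ⟨⟨f, (domain_A₀_add_A₁ hr hrθ).ge hf⟩, rfl, X.ext fun n => ?_⟩
    rw [hv, hg]

/-- Truncations have finite support; together with `tendsto_truncL` this makes every multiplication
domain dense. -/
theorem truncL_mem_mulDomain (w : ℕ+ → ℝ) (N : ℕ) (f : X) : X.truncL N f ∈ mulDomain w := by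
  refine summable_of_hasFiniteSupport ((Set.finite_Iic N.succPNat).subset fun n hn => ?_)
  by_contra h
  refine hn ?_
  have h1 : ¬ (n : ℕ) ≤ N := fun h2 => h <| by
    rw [Set.mem_Iic, ← PNat.coe_le_coe, Nat.succPNat_coe]
    omega
  simp [X.truncL_apply, h1]

/-- If `d_n + a_n ≥ C r_n` with `C > 0`, then `1 - (A₀ + A₁)` is onto. -/
theorem exists_sub_eq (hr : ∀ n, 0 ≤ r n) (hrθ : ∀ n, r n ≤ theta r a d n) {C : ℝ} (hC : 0 < C)
    (h : ∀ n, C * r n ≤ d n + a n) (y : X) :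
    ∃ f g, (f, g) ∈ (A₀ r a d + A₁ r).graph ∧ f - g = y := by
  set θ := theta r a d with hθ
  have hθ0 : ∀ n, 0 ≤ θ n := fun n => (hr n).trans (hrθ n)
  have h1θ : ∀ n, 0 < 1 + θ n := fun n => by linarith [hθ0 n]
  -- The assumption enters here: (1 + C)r ≤ r + a + d = θ < 1 + θ.
  have hq : ∀ n, |r n / (1 + θ n)| ≤ (1 + C)⁻¹ := fun n => by
    rw [abs_of_nonneg (div_nonneg (hr n) (h1θ n).le), div_le_iff₀ (h1θ n),
      le_inv_mul_iff₀ (by positivity)]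
    have := h n
    simp only [hθ, theta]
    linarith
  have hm : ∀ n, |(1 + θ n)⁻¹| ≤ 1 := fun n => by
    rw [abs_of_pos (inv_pos.2 (h1θ n))]
    exact inv_le_one_of_one_le₀ (by linarith [hθ0 n])
  set Q : X →L[ℝ] X := X.shiftL.comp (X.mulL _ _ hq) with hQ
  have hQ1 : ‖Q‖ < 1 := by
    refine (ContinuousLinearMap.opNorm_le_bound Q (by positivity) fun f => ?_).trans_lt
      (inv_lt_one_of_one_lt₀ (by linarith : 1 < 1 + C))
    refine (X.norm_shiftL_le _).trans (X.norm_le_mul_norm fun n => ?_)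
    change |r n / (1 + θ n) * f n| ≤ _
    rw [abs_mul]
    exact mul_le_mul_of_nonneg_right (hq n) (abs_nonneg _)
  obtain ⟨R, hR⟩ := (isUnit_one_sub_of_norm_lt_one hQ1).exists_right_inv
  set u := R y with hu
  have huy : u - Q u = y := congrArg (fun B : X →L[ℝ] X => B y) hR
  set f := X.mulL _ _ hm u with hf
  have hfn : ∀ n, f n = (1 + θ n)⁻¹ * u n := fun n => rfl
  have hfu : ∀ n, θ n * f n = u n - f n := fun n => by
    have := h1θ n
    rw [hfn]
    field_simp
    ring
  refine ⟨f, f - y, (mem_graph_A₀_add_A₁ hr hrθ).2 ⟨?_, fun n => ?_⟩, by abel⟩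
  -- Membership in D(A₀) holds because θf = u - f lies in X.
  · exact (u - f).memX.of_le fun n => (congrArg abs (hfu n)).le
  · have h2 : Q u n = r (n + 1) / (1 + θ (n + 1)) * u (n + 1) := rfl
    rw [← huy, hfu, X.sub_apply, X.sub_apply, h2, hfn (n + 1)]
    ring

end Decay

end DecayFragmentation
-- Proof of the theorem
open DecayFragmentation in
theorem mainTheorem9 (r a d : ℕ+ → ℝ)
    (hr : ∀ n, 0 < r n) (hd : ∀ n, 0 ≤ d n) (ha1 : a 1 = 0) (ha : ∀ n, 2 ≤ n → 0 < a n)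
    (C : ℝ) (hC : 0 < C) (h : ∀ n, C * r n ≤ d n + a n) :
    (∃ K, IsMinimalSubstochasticGenerator (A₀ r a d + A₁ r) K) ∧
    (∀ K, IsMinimalSubstochasticGenerator (A₀ r a d + A₁ r) K →
      K.domain = (A₀ r a d).domain ∧ K = A₀ r a d + A₁ r) ∧
    (A₀ r a d + A₁ r).IsClosed := by
  have hr0 : ∀ n, 0 ≤ r n := fun n => (hr n).le
  have hrθ : ∀ n, r n ≤ theta r a d n := fun n => by
    have := h n
    have := mul_pos hC (hr n)
    simp only [theta]
    linarith
  set T := A₀ r a d + A₁ r with hT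
  have hdom : T.domain = (A₀ r a d).domain := domain_A₀_add_A₁ hr0 hrθ
  have hsurj := exists_sub_eq hr0 hrθ hC h
  -- every extension of `T` generating a substochastic semigroup equals `T`
  have hmax : ∀ (K : X →ₗ.[ℝ] X) (S : ℝ≥0 → X →L[ℝ] X), T ≤ K → IsSubstochasticSemigroup S →
      IsGenerator S K → K = T := by
    intro K S hTK hS hK
    refine le_antisymm (LinearPMap.le_of_le_graph fun p hp => ?_) hTK
    exact hS.mem_graph_of_surjective
      (fun f g hfg => (hK f g).1 (LinearPMap.le_graph_of_le hTK hfg)) hsurj ((hK _ _).1 hp)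
  obtain ⟨S, hSlim⟩ := exists_tendsto_exp_truncGen hr0 hrθ
  have hS := isSubstochasticSemigroup_of_tendsto hr0 hrθ hSlim
  have hSgen : ∀ f g, (f, g) ∈ T.graph →
      Tendsto (fun t : ℝ≥0 => (t : ℝ)⁻¹ • (S t f - f)) (𝓝[>] 0) (𝓝 g) := by
    intro f g hfg
    obtain ⟨hf, hg⟩ := (mem_graph_A₀_add_A₁ hr0 hrθ).1 hfg
    have hf1 : f ∈ mulDomain r := (hdom.ge hf : f ∈ T.domain).2
    exact tendsto_inv_smul_limit_sub hr0 hrθ hSlim (tendsto_truncGen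
      (u := X.mk _ hf) (v := X.mk _ hf1) (fun _ => rfl) (fun _ => rfl) hg)
  have hSK : IsGenerator S T := fun f g =>
    ⟨hSgen f g, fun hg => hS.mem_graph_of_surjective hSgen hsurj hg⟩
  refine ⟨⟨T, le_rfl, S, hS, hSK, ?_⟩, ?_, hS.isClosed_of_surjective hSK hsurj⟩
  -- The competitor's generator is T by `hmax`, so both semigroups agree on D(T), and on all of X by
  -- density of the truncations. The inequality is thus an equality.
  · intro K' S' hK' hS' hgen t f _ n
    obtain rfl := hmax K' S' hK' hS' hgen
    have hmem : ∀ N, X.truncL N f ∈ T.domain := fun N =>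
      hdom.ge (truncL_mem_mulDomain _ N f)
    have : S t f = S' t f := tendsto_nhds_unique
      (((S t).continuous.tendsto f).comp (X.tendsto_truncL f))
      ((((S' t).continuous.tendsto f).comp (X.tendsto_truncL f)).congr fun N =>
        (hS.eq_of_isGenerator hS' hSK hgen (hmem N) t).symm)
    rw [this]
  · rintro K ⟨hTK, S', hS', hK, -⟩
    have := hmax K S' hTK hS' hK
    exact ⟨this ▸ hdom, this⟩
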